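/- **Setting.** Let $\bar M$ be a (Hausdorff) complex manifold of complex dimension $2m+1$ with complex structure $J$, Hermitian metric $g$ and Levi-Civita connection $\bar\nabla$. A *complex almost contact metric structure* on $\bar M$ consists of an open covering $\{\mathcal U_i\}$ and, on each $\mathcal U_i$, a smooth unit vector field $U$ with dual 1-form $u=g(\cdot,U)$, $V=-JU$, $v=u\circ J$, and smooth $(1,1)$-tensors $G$, $H=GJ$ such that $$G^2=H^2=-I+u\otimes U+v\otimes V,\quad GJ=-JG,\quad GU=0,\quad g(K,GL)=-g(GK,L),$$ and on $\mathcal U_i\cap\mathcal U_j$ one has $u_j=cu_i-dv_i$, $v_j=du_i+cv_i$, $G_j=cG_i-dH_i$, $H_j=dG_i+cH_i$ for functions $c,d$ with $c^2+d^2=1$. It is a *complex contact metric structure* if moreover, with $\sigma(K)=g(\bar\nabla_KU,V)$, $$du(K,L)=g(K,GL)+(\sigma\wedge v)(K,L),\qquad dv(K,L)=g(K,HL)-(\sigma\wedge u)(K,L),$$ where $2\,d\theta(K,L)=K\theta(L)-L\theta(K)-\theta([K,L])$ and $2(\alpha\wedge\beta)(K,L)=\alpha(K)\beta(L)-\alpha(L)\beta(K)$.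 Put $$\begin{aligned}S(K,L)={}&[G,G](K,L)+2g(K,GL)U-2g(K,HL)V+2(v(L)HK-v(K)HL)\\&+\sigma(GL)HK-\sigma(GK)HL+\sigma(K)GHL-\sigma(L)GHK,\\ T(K,L)={}&[H,H](K,L)-2g(K,GL)U+2g(K,HL)V+2(u(L)GK-u(K)GL)\\&+\sigma(HK)GL-\sigma(HL)GK+\sigma(K)GHL-\sigma(L)GHK,\end{aligned}$$ where $[A,A](K,L)=(\bar\nabla_{AK}A)L-(\bar\nabla_{AL}A)K-A(\bar\nabla_KA)L+A(\bar\nabla_LA)K$. The structure is *normal* if $S(K,L)=T(K,L)=0$ for all $K,L\in\ker u\cap\ker v$, and $S(K,U)=T(K,V)=0$ for all $K$. Let $M$ be a (Hausdorff, immersed) complex submanifold of such a normal complex contact metric manifold $\bar M$, to which all the vector fields $U,V$ are tangent. For $p\in M$ let $$\mathcal D_p=\{K\in T_pM: K\perp U,V,\ GK\in T_pM\},\qquad \mathcal D^\perp_p=\{K\in T_pM: K\perp U,V,\ GK\perp T_pM\};$$ these do not depend on the choice of the local fields. $M$ is *semi-invariant* if $\mathcal D$ and $\mathcal D^\perp$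 have constant dimension and are smooth distributions on $M$. It is *proper* if it is neither invariant ($\dim\mathcal D^\perp=0$) nor anti-invariant ($\dim\mathcal D=0$). **Corollary.** If $M$ is a proper semi-invariant submanifold of a normal complex contact metric manifold, then the distribution $\mathcal D\oplus\mathcal D^\perp$ on $M$ is not involutive: there are smooth vector fields $K,L$ on $M$ with values in $\mathcal D\oplus\mathcal D^\perp$ whose bracket $[K,L]$ does not take all its values in $\mathcal D\oplus\mathcal D^\perp$. -/

import Mathlib

open scoped Manifold ContDiff Topology Bundle

noncomputable section

namespace ComplexContact

/-! ### Complex manifolds as real manifolds -/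

/-- A complex manifold is a smooth real manifold, with the same charts. -/
instance isManifold_real_of_complex {E M : Type*} [NormedAddCommGroup E] [NormedSpace ℂ E]
    [TopologicalSpace M] [ChartedSpace E M] [h : IsManifold 𝓘(ℂ, E) ω M] :
    IsManifold 𝓘(ℝ, E) ∞ M := by
  refine isManifold_of_contDiffOn 𝓘(ℝ, E) ∞ M fun e e' he he' => ?_
  have h1 := (contDiffGroupoid ω 𝓘(ℂ, E)).compatible he he'
  rw [contDiffGroupoid, mem_groupoid_of_pregroupoid] at h1
  exact (ContDiffOn.restrict_scalars ℝ h1.1).of_le (by exact_mod_cast le_top)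

section Ambient

variable {E : Type*} [NormedAddCommGroup E] [NormedSpace ℂ E]
  {M : Type*} [TopologicalSpace M] [ChartedSpace E M] [IsManifold 𝓘(ℂ, E) ω M]

/-- The complex structure `J` of a complex manifold: multiplication by `i` on each tangent space.
As the changes of charts are holomorphic, it does not depend on the chart. -/
def J (p : M) : TangentSpace 𝓘(ℝ, E) p →L[ℝ] TangentSpace 𝓘(ℝ, E) p :=
  (Complex.I • ContinuousLinearMap.id ℝ E : E →L[ℝ] E)

/-- The vector field `X` is smooth at `p`. -/
def SmoothVFAt (X : Π p : M, TangentSpace 𝓘(ℝ, E) p) (p : M) : Prop :=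
  ContMDiffAt 𝓘(ℝ, E) (𝓘(ℝ, E).prod 𝓘(ℝ, E)) ∞
    (fun q => (⟨q, X q⟩ : Bundle.TotalSpace E (fun q : M => TangentSpace 𝓘(ℝ, E) q))) p

/-- The field `A` of endomorphisms of the tangent spaces (a `(1,1)`-tensor) is smooth at `p`. -/
def SmoothEndAt
    (A : Π p : M, TangentSpace 𝓘(ℝ, E) p →L[ℝ] TangentSpace 𝓘(ℝ, E) p) (p : M) : Prop :=
  ContMDiffAt 𝓘(ℝ, E) (𝓘(ℝ, E).prod 𝓘(ℝ, E →L[ℝ] E)) ∞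
    (fun q => (⟨q, A q⟩ : Bundle.TotalSpace (E →L[ℝ] E)
      (fun q : M => TangentSpace 𝓘(ℝ, E) q →L[ℝ] TangentSpace 𝓘(ℝ, E) q))) p

/-- The exterior derivative of a `1`-form, with the convention
`2 dθ(K, L) = K (θ L) - L (θ K) - θ [K, L]`. -/
def extD (θ : Π p : M, TangentSpace 𝓘(ℝ, E) p → ℝ) (K L : Π p : M, TangentSpace 𝓘(ℝ, E) p)
    (p : M) : ℝ :=
  (1 / 2) * (mvfderiv 𝓘(ℝ, E) (fun q => θ q (L q)) p (K p)
    - mvfderiv 𝓘(ℝ, E) (fun q => θ q (K q)) p (L p)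
    - θ p (VectorField.mlieBracket 𝓘(ℝ, E) K L p))

/-- The wedge product of two covectors, with the matching convention
`2 (α ∧ β)(k, l) = α k * β l - α l * β k`. -/
def wedge {T : Type*} (α β : T → ℝ) (k l : T) : ℝ :=
  (1 / 2) * (α k * β l - α l * β k)

/-- A distribution (a field of subspaces of the tangent spaces) is differentiable if each of its
vectors extends locally to a smooth vector field that lies in the distribution. -/
def IsSmoothDistribution (Δ : Π p : M, Submodule ℝ (TangentSpace 𝓘(ℝ, E) p)) : Prop :=
  ∀ p : M, ∀ k ∈ Δ p, ∃ K : Π q : M, TangentSpace 𝓘(ℝ, E) q,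
    K p = k ∧ ∀ᶠ q in 𝓝 p, SmoothVFAt K q ∧ K q ∈ Δ q

/-- A distribution is involutive if the bracket of any two smooth vector fields lying in it lies
in it. -/
def IsInvolutive (Δ : Π p : M, Submodule ℝ (TangentSpace 𝓘(ℝ, E) p)) : Prop :=
  ∀ K L : Π p : M, TangentSpace 𝓘(ℝ, E) p,
    (∀ p, SmoothVFAt K p) → (∀ p, SmoothVFAt L p) →
    (∀ p, K p ∈ Δ p) → (∀ p, L p ∈ Δ p) →
      ∀ p, VectorField.mlieBracket 𝓘(ℝ, E) K L p ∈ Δ p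

section Submanifold

variable {E' : Type*} [NormedAddCommGroup E'] [NormedSpace ℂ E']
  {N : Type*} [TopologicalSpace N] [ChartedSpace E' N] [IsManifold 𝓘(ℂ, E') ω N]

variable (E E') in
/-- The (real) differential of a map between complex manifolds. -/
def df (f : N → M) (p : N) : TangentSpace 𝓘(ℝ, E') p →L[ℝ] TangentSpace 𝓘(ℝ, E) (f p) :=
  mfderiv 𝓘(ℝ, E') 𝓘(ℝ, E) f p

variable (E E') in
/-- `f` makes `N` a complex (immersed) submanifold of `M`: it is holomorphic and its differential is
injective at each point. -/
structure IsComplexSubmanifold (f : N → M) : Prop where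
  holomorphic : ContMDiff 𝓘(ℂ, E') 𝓘(ℂ, E) ω f
  immersion : ∀ p : N, Function.Injective (df E E' f p)

end Submanifold

section Metric

variable [FiniteDimensional ℂ E]
  [Bundle.RiemannianBundle (fun p : M => TangentSpace 𝓘(ℝ, E) p)]
  [IsContMDiffRiemannianBundle 𝓘(ℝ, E) ∞ E (fun p : M => TangentSpace 𝓘(ℝ, E) p)]

/-- `nabla` is the Levi-Civita connection of the Riemannian metric of `M`: it is torsion free and
compatible with the metric. `nabla Y p (X p)` is `(∇_X Y)(p)`. -/
structure IsLeviCivita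
    (nabla : CovariantDerivative 𝓘(ℝ, E) E (fun p : M => TangentSpace 𝓘(ℝ, E) p)) : Prop where
  metric : CovariantDerivative.IsMetricCompatible (V := fun p : M => TangentSpace 𝓘(ℝ, E) p) nabla
  torsion_free : haveI : CompleteSpace E := FiniteDimensional.complete ℝ E
    nabla.torsion = 0

/-! ### Normal complex contact metric manifolds -/

variable (E M) in
/-- An open covering `dom i` with, on each `dom i`, a vector field `U i` and a `(1,1)`-tensor `G i`.
Values outside `dom i` are never used. -/
structure LocalFields (ι : Type*) where
  dom : ι → Set M
  U : ι → Π p : M, TangentSpace 𝓘(ℝ, E) p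
  G : ι → Π p : M, TangentSpace 𝓘(ℝ, E) p →L[ℝ] TangentSpace 𝓘(ℝ, E) p

namespace LocalFields

variable {ι : Type*} (S : LocalFields E M ι) (i : ι)

/-- The local vector field `V = -J U`. -/
def V (p : M) : TangentSpace 𝓘(ℝ, E) p := -J p (S.U i p)

/-- The local `(1,1)`-tensor `H = G J`. -/
def H (p : M) : TangentSpace 𝓘(ℝ, E) p →L[ℝ] TangentSpace 𝓘(ℝ, E) p := (S.G i p).comp (J p)

/-- The local `1`-form `u` dual to `U`. -/
def u (p : M) (k : TangentSpace 𝓘(ℝ, E) p) : ℝ := inner ℝ k (S.U i p)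

/-- The local `1`-form `v = u ∘ J`. -/
def v (p : M) (k : TangentSpace 𝓘(ℝ, E) p) : ℝ := S.u i p (J p k)

/-- The Riemannian metric of `M` and the local fields `U`, `G` (with `V = -J U`, `H = G J`, `u` dual
to `U` and `v = u ∘ J`) form a complex almost contact metric structure. -/
structure IsComplexAlmostContactMetric : Prop where
  isOpen_dom : ∀ i, IsOpen (S.dom i)
  cover : ⋃ i, S.dom i = Set.univ
  /-- the metric is Hermitian -/
  hermitian : ∀ (p : M) (k l : TangentSpace 𝓘(ℝ, E) p), inner ℝ (J p k) (J p l) = inner ℝ k l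
  smooth_U : ∀ i, ∀ p ∈ S.dom i, SmoothVFAt (S.U i) p
  smooth_G : ∀ i, ∀ p ∈ S.dom i, SmoothEndAt (S.G i) p
  u_U : ∀ i, ∀ p ∈ S.dom i, S.u i p (S.U i p) = 1
  G_sq : ∀ i, ∀ p ∈ S.dom i, ∀ k, S.G i p (S.G i p k) =
    -k + S.u i p k • S.U i p + S.v i p k • S.V i p
  H_sq : ∀ i, ∀ p ∈ S.dom i, ∀ k, S.H i p (S.H i p k) =
    -k + S.u i p k • S.U i p + S.v i p k • S.V i p
  G_J : ∀ i, ∀ p ∈ S.dom i, ∀ k, S.G i p (J p k) = -J p (S.G i p k)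
  G_U : ∀ i, ∀ p ∈ S.dom i, S.G i p (S.U i p) = 0
  G_skew : ∀ i, ∀ p ∈ S.dom i, ∀ k l : TangentSpace 𝓘(ℝ, E) p,
    inner ℝ k (S.G i p l) = -inner ℝ (S.G i p k) l
  /-- the change of local fields on the overlaps -/
  overlap : ∀ i j, ∀ p ∈ S.dom i ∩ S.dom j, ∃ c d : ℝ, c ^ 2 + d ^ 2 = 1 ∧
    ∀ k : TangentSpace 𝓘(ℝ, E) p,
      S.u j p k = c * S.u i p k - d * S.v i p k ∧
      S.v j p k = d * S.u i p k + c * S.v i p k ∧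
      S.G j p k = c • S.G i p k - d • S.H i p k ∧
      S.H j p k = d • S.G i p k + c • S.H i p k

variable (nabla : CovariantDerivative 𝓘(ℝ, E) E (fun p : M => TangentSpace 𝓘(ℝ, E) p))

/-- The local `1`-form `σ(K) = g(∇_K U, V)`. -/
def sigma (p : M) (k : TangentSpace 𝓘(ℝ, E) p) : ℝ := inner ℝ (nabla (S.U i) p k) (S.V i p)

/-- A complex contact metric structure: a complex almost contact metric structure with
`du(K, L) = g(K, GL) + (σ ∧ v)(K, L)` and `dv(K, L) = g(K, HL) - (σ ∧ u)(K, L)`. These equations make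
`ker u ∩ ker v` a holomorphic subbundle and `u - i v` a nonvanishing multiple of local holomorphic
contact forms, so the complex contact structure of `M` is not a separate datum. -/
structure IsComplexContactMetric : Prop extends S.IsComplexAlmostContactMetric where
  d_u : ∀ i, ∀ p ∈ S.dom i, ∀ K L : Π q : M, TangentSpace 𝓘(ℝ, E) q,
    SmoothVFAt K p → SmoothVFAt L p →
      extD (S.u i) K L p =
        inner ℝ (K p) (S.G i p (L p)) + wedge (S.sigma i nabla p) (S.v i p) (K p) (L p)
  d_v : ∀ i, ∀ p ∈ S.dom i, ∀ K L : Π q : M, TangentSpace 𝓘(ℝ, E) q,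
    SmoothVFAt K p → SmoothVFAt L p →
      extD (S.v i) K L p =
        inner ℝ (K p) (S.H i p (L p)) - wedge (S.sigma i nabla p) (S.u i p) (K p) (L p)

/-- `(∇_k A) L` at `p`, for a `(1,1)`-tensor `A`, a vector field `L` and a tangent vector `k`:
it is `∇_k (A L) - A (∇_k L)`. -/
def nablaEnd (A : Π p : M, TangentSpace 𝓘(ℝ, E) p →L[ℝ] TangentSpace 𝓘(ℝ, E) p)
    (L : Π p : M, TangentSpace 𝓘(ℝ, E) p) (p : M) (k : TangentSpace 𝓘(ℝ, E) p) :
    TangentSpace 𝓘(ℝ, E) p :=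
  nabla (fun q => A q (L q)) p k - A p (nabla L p k)

/-- The Nijenhuis torsion
`[A, A](K, L) = (∇_{AK} A) L - (∇_{AL} A) K - A (∇_K A) L + A (∇_L A) K`. -/
def nijenhuis (A : Π p : M, TangentSpace 𝓘(ℝ, E) p →L[ℝ] TangentSpace 𝓘(ℝ, E) p)
    (K L : Π p : M, TangentSpace 𝓘(ℝ, E) p) (p : M) : TangentSpace 𝓘(ℝ, E) p :=
  nablaEnd nabla A L p (A p (K p)) - nablaEnd nabla A K p (A p (L p))
    - A p (nablaEnd nabla A L p (K p)) + A p (nablaEnd nabla A K p (L p))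

/-- The tensor `S` of Ishihara and Konishi. -/
def tensorS (K L : Π p : M, TangentSpace 𝓘(ℝ, E) p) (p : M) : TangentSpace 𝓘(ℝ, E) p :=
  let G := S.G i p
  let H := S.H i p
  let s := S.sigma i nabla p
  let k := K p
  let l := L p
  nijenhuis nabla (S.G i) K L p
    + (2 * inner ℝ k (G l)) • S.U i p - (2 * inner ℝ k (H l)) • S.V i p
    + (2 : ℝ) • (S.v i p l • H k - S.v i p k • H l)
    + s (G l) • H k - s (G k) • H l + s k • G (H l) - s l • G (H k)

/-- The tensor `T` of Ishihara and Konishi. -/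
def tensorT (K L : Π p : M, TangentSpace 𝓘(ℝ, E) p) (p : M) : TangentSpace 𝓘(ℝ, E) p :=
  let G := S.G i p
  let H := S.H i p
  let s := S.sigma i nabla p
  let k := K p
  let l := L p
  nijenhuis nabla (S.H i) K L p
    - (2 * inner ℝ k (G l)) • S.U i p + (2 * inner ℝ k (H l)) • S.V i p
    + (2 : ℝ) • (S.u i p l • G k - S.u i p k • G l)
    + s (H k) • G l - s (H l) • G k + s k • G (H l) - s l • G (H k)

/-- Normality in the sense of Korkmaz: `S` and `T` vanish on the horizontal subbundle
`ker u ∩ ker v`, and `S(K, U) = T(K, V) = 0` for all `K`. -/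
structure IsNormal : Prop where
  horizontal : ∀ i, ∀ p ∈ S.dom i, ∀ K L : Π q : M, TangentSpace 𝓘(ℝ, E) q,
    SmoothVFAt K p → SmoothVFAt L p →
    S.u i p (K p) = 0 → S.v i p (K p) = 0 → S.u i p (L p) = 0 → S.v i p (L p) = 0 →
      S.tensorS i nabla K L p = 0 ∧ S.tensorT i nabla K L p = 0
  vertical : ∀ i, ∀ p ∈ S.dom i, ∀ K : Π q : M, TangentSpace 𝓘(ℝ, E) q, SmoothVFAt K p →
      S.tensorS i nabla K (S.U i) p = 0 ∧ S.tensorT i nabla K (S.V i) p = 0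

end LocalFields

/-! ### Semi-invariant submanifolds -/

section SemiInvariant

variable {E' : Type*} [NormedAddCommGroup E'] [NormedSpace ℂ E']
  {N : Type*} [TopologicalSpace N] [ChartedSpace E' N] [IsManifold 𝓘(ℂ, E') ω N]
  {ι : Type*} (S : LocalFields E M ι) (f : N → M)

variable (E') in
/-- `U` and `V` are tangent to the submanifold. -/
def TangentUV : Prop :=
  ∀ p : N, ∀ i, f p ∈ S.dom i →
    S.U i (f p) ∈ (df E E' f p).range ∧ S.V i (f p) ∈ (df E E' f p).range

/-- The distribution `D` of the submanifold: the tangent vectors `K` orthogonal to `U` and `V` for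
which the normal part `QK` of `GK` vanishes, that is, `GK` is tangent to the submanifold. -/
def distD (p : N) : Submodule ℝ (TangentSpace 𝓘(ℝ, E') p) where
  carrier := {k | ∀ i, f p ∈ S.dom i →
    inner ℝ (df E E' f p k) (S.U i (f p)) = 0 ∧ inner ℝ (df E E' f p k) (S.V i (f p)) = 0 ∧
      S.G i (f p) (df E E' f p k) ∈ (df E E' f p).range}
  zero_mem' i _ := by simp
  add_mem' {a b} ha hb i hi := by
    obtain ⟨h1, h2, h3⟩ := ha i hi
    obtain ⟨h4, h5, h6⟩ := hb i hi
    refine ⟨?_, ?_, ?_⟩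
    · rw [map_add, inner_add_left, h1, h4, add_zero]
    · rw [map_add, inner_add_left, h2, h5, add_zero]
    · rw [map_add, map_add]; exact Submodule.add_mem _ h3 h6
  smul_mem' c a ha i hi := by
    obtain ⟨h1, h2, h3⟩ := ha i hi
    refine ⟨?_, ?_, ?_⟩
    · rw [map_smul, real_inner_smul_left, h1, mul_zero]
    · rw [map_smul, real_inner_smul_left, h2, mul_zero]
    · rw [map_smul, map_smul]; exact Submodule.smul_mem _ c h3

/-- The distribution `D^⊥` of the submanifold: the tangent vectors `K` orthogonal to `U` and `V` for
which the tangential part `PK` of `GK` vanishes, that is, `GK` is normal to the submanifold. -/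
def distDPerp (p : N) : Submodule ℝ (TangentSpace 𝓘(ℝ, E') p) where
  carrier := {k | ∀ i, f p ∈ S.dom i →
    inner ℝ (df E E' f p k) (S.U i (f p)) = 0 ∧ inner ℝ (df E E' f p k) (S.V i (f p)) = 0 ∧
      ∀ z : TangentSpace 𝓘(ℝ, E') p, inner ℝ (S.G i (f p) (df E E' f p k)) (df E E' f p z) = 0}
  zero_mem' i _ := by simp
  add_mem' {a b} ha hb i hi := by
    obtain ⟨h1, h2, h3⟩ := ha i hi
    obtain ⟨h4, h5, h6⟩ := hb i hi
    refine ⟨?_, ?_, fun z => ?_⟩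
    · rw [map_add, inner_add_left, h1, h4, add_zero]
    · rw [map_add, inner_add_left, h2, h5, add_zero]
    · rw [map_add, map_add, inner_add_left, h3, h6, add_zero]
  smul_mem' c a ha i hi := by
    obtain ⟨h1, h2, h3⟩ := ha i hi
    refine ⟨?_, ?_, fun z => ?_⟩
    · rw [map_smul, real_inner_smul_left, h1, mul_zero]
    · rw [map_smul, real_inner_smul_left, h2, mul_zero]
    · rw [map_smul, map_smul, real_inner_smul_left, h3, mul_zero]

variable (E') in
/-- A complex submanifold tangent to `U` and `V` is semi-invariant if `D` and `D^⊥` have constant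
dimension and are differentiable. -/
structure IsSemiInvariant : Prop where
  submanifold : IsComplexSubmanifold E E' f
  tangent : TangentUV E' S f
  finrank_D : ∃ r : ℕ, ∀ p : N, Module.finrank ℝ (distD (E' := E') S f p) = r
  finrank_DPerp : ∃ r : ℕ, ∀ p : N, Module.finrank ℝ (distDPerp (E' := E') S f p) = r
  smooth_D : IsSmoothDistribution (distD (E' := E') S f)
  smooth_DPerp : IsSmoothDistribution (distDPerp (E' := E') S f)

variable (E') in
/-- A semi-invariant submanifold is proper if it is neither invariant (`dim D^⊥ = 0`) nor
anti-invariant (`dim D = 0`). -/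
structure IsProperSemiInvariant : Prop extends IsSemiInvariant E' S f where
  not_invariant : ¬ ∀ p : N, Module.finrank ℝ (distDPerp (E' := E') S f p) = 0
  not_antiInvariant : ¬ ∀ p : N, Module.finrank ℝ (distD (E' := E') S f p) = 0

end SemiInvariant

end Metric
end Ambient
end ComplexContact
end

noncomputable section

namespace ComplexContact

section Flat

variable {F F' : Type*} [NormedAddCommGroup F] [NormedSpace ℝ F]
  [NormedAddCommGroup F'] [NormedSpace ℝ F']

/-- A map into the dual of a finite-dimensional space is differentiable if it is so pointwise. -/
theorem differentiableAt_of_apply [FiniteDimensional ℝ F] {Θ : F' → F →L[ℝ] ℝ} {x : F'}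
    (h : ∀ w, DifferentiableAt ℝ (fun y => Θ y w) x) : DifferentiableAt ℝ Θ x := by
  let d := Module.finrank ℝ F
  have hd : d = Module.finrank ℝ (Fin d → ℝ) := (Module.finrank_fin_fun ℝ).symm
  let e₁ := ContinuousLinearEquiv.ofFinrankEq hd
  let e₂ := (e₁.arrowCongr (1 : ℝ ≃L[ℝ] ℝ)).trans (ContinuousLinearEquiv.piRing (Fin d))
  rw [← Function.id_comp Θ, ← e₂.symm_comp_self]
  exact e₂.symm.differentiableAt.comp x (differentiableAt_pi.mpr fun i => h _)

/-- The formula for the exterior derivative of the pullback of a `1`-form `Θ` by `φ`, for vector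
fields on which the pullback vanishes. -/
theorem fderiv_oneForm_pullback {φ : F' → F} {x : F'} (hφ : ContDiffAt ℝ 2 φ x)
    {Θ : F → F →L[ℝ] ℝ} (hΘ : DifferentiableAt ℝ Θ (φ x)) {K L : F' → F'}
    (hK : DifferentiableAt ℝ K x) (hL : DifferentiableAt ℝ L x)
    (hΘK : ∀ᶠ y in 𝓝 x, Θ (φ y) (fderiv ℝ φ y (K y)) = 0)
    (hΘL : ∀ᶠ y in 𝓝 x, Θ (φ y) (fderiv ℝ φ y (L y)) = 0) :
    fderiv ℝ Θ (φ x) (fderiv ℝ φ x (K x)) (fderiv ℝ φ x (L x))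
      - fderiv ℝ Θ (φ x) (fderiv ℝ φ x (L x)) (fderiv ℝ φ x (K x))
      = -Θ (φ x) (fderiv ℝ φ x (VectorField.lieBracket ℝ K L x)) := by
  have hφ1 : DifferentiableAt ℝ φ x := hφ.differentiableAt (by norm_num)
  have hφ2 : DifferentiableAt ℝ (fderiv ℝ φ) x :=
    (hφ.fderiv_right (m := 1) (by norm_num)).differentiableAt (by norm_num)
  have key : ∀ {A : F' → F'}, DifferentiableAt ℝ A x →
      (∀ᶠ y in 𝓝 x, Θ (φ y) (fderiv ℝ φ y (A y)) = 0) → ∀ b : F',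
      fderiv ℝ Θ (φ x) (fderiv ℝ φ x b) (fderiv ℝ φ x (A x))
        + Θ (φ x) (fderiv ℝ (fderiv ℝ φ) x b (A x) + fderiv ℝ φ x (fderiv ℝ A x b)) = 0 := by
    intro A hA h0 b
    have h1 := (hΘ.hasFDerivAt.comp x hφ1.hasFDerivAt).clm_apply
      (hφ2.hasFDerivAt.clm_apply hA.hasFDerivAt)
    have h2 := h1.unique ((hasFDerivAt_const (0 : ℝ) x).congr_of_eventuallyEq h0)
    have h3 := congrArg (fun T : F' →L[ℝ] ℝ => T b) h2
    simp at h3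
    simp only [map_add]
    linarith
  have hs : IsSymmSndFDerivAt ℝ φ x := hφ.isSymmSndFDerivAt (by simp)
  have e1 := key hL hΘL (K x)
  have e2 := key hK hΘK (L x)
  rw [hs (L x) (K x)] at e2
  simp only [VectorField.lieBracket, map_sub, map_add] at e1 e2 ⊢
  linarith

end Flat

section Extension

variable {E : Type*} [NormedAddCommGroup E] [NormedSpace ℂ E] [FiniteDimensional ℂ E]
  {M : Type*} [TopologicalSpace M] [T2Space M] [ChartedSpace E M] [IsManifold 𝓘(ℂ, E) ω M]

/-- A tangent vector in a smooth distribution extends to a global smooth vector field in it. -/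
theorem IsSmoothDistribution.exists_global {Δ : Π p : M, Submodule ℝ (TangentSpace 𝓘(ℝ, E) p)}
    (hΔ : IsSmoothDistribution Δ) {p : M} {k : TangentSpace 𝓘(ℝ, E) p} (hk : k ∈ Δ p) :
    ∃ K : Π q : M, TangentSpace 𝓘(ℝ, E) q,
      K p = k ∧ (∀ q, SmoothVFAt K q) ∧ ∀ q, K q ∈ Δ q := by
  have : FiniteDimensional ℝ E := FiniteDimensional.complexToReal E
  obtain ⟨K, hKp, hK⟩ := hΔ p k hk
  obtain ⟨O, hO, hOo, hpO⟩ := eventually_nhds_iff.1 hK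
  obtain ⟨χ, -, hχ⟩ := (SmoothBumpFunction.nhds_basis_tsupport (I := 𝓘(ℝ, E)) p).mem_iff.1
    (hOo.mem_nhds hpO)
  refine ⟨fun q => χ q • K q, by simp [hKp], fun q => ?_, fun q => ?_⟩
  · have := ContMDiffOn.smul_section_of_tsupport (V := fun q : M => TangentSpace 𝓘(ℝ, E) q)
      (s := K) (ψ := χ) (n := ∞) (u := O) (I := 𝓘(ℝ, E)) (F := E) χ.contMDiff.contMDiffOn hOo hχ
      (fun q hq => (hO q hq).1.contMDiffWithinAt)
    exact this q
  · by_cases hq : q ∈ O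
    · exact (Δ q).smul_mem _ (hO q hq).2
    · have : χ q = 0 := image_eq_zero_of_notMem_tsupport fun h => hq (hχ h)
      simp [this]

end Extension

section Pullback

variable {E : Type*} [NormedAddCommGroup E] [NormedSpace ℂ E]
  {M : Type*} [TopologicalSpace M] [ChartedSpace E M]

/-- The vector field with constant coordinates `w` in the chart at `p`. -/
def chartField (p : M) (w : E) (q : M) : TangentSpace 𝓘(ℝ, E) q :=
  VectorField.mpullback 𝓘(ℝ, E) 𝓘(ℝ, E) (extChartAt 𝓘(ℝ, E) p) (fun _ => w) q

/-- The coordinate expression of a `1`-form in the chart at `p`. -/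
def chartForm (θ : Π q : M, TangentSpace 𝓘(ℝ, E) q →L[ℝ] ℝ) (p : M) (y : E) : E →L[ℝ] ℝ :=
  (θ ((extChartAt 𝓘(ℝ, E) p).symm y)).comp
    (mfderiv 𝓘(ℝ, E) 𝓘(ℝ, E) (extChartAt 𝓘(ℝ, E) p) ((extChartAt 𝓘(ℝ, E) p).symm y)).inverse

theorem chartForm_apply (θ : Π q : M, TangentSpace 𝓘(ℝ, E) q →L[ℝ] ℝ) {p q : M}
    (hq : q ∈ (extChartAt 𝓘(ℝ, E) p).source) (w : E) :
    chartForm θ p (extChartAt 𝓘(ℝ, E) p q) w = θ q (chartField p w q) := by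
  change θ _ (chartField p w ((extChartAt 𝓘(ℝ, E) p).symm (extChartAt 𝓘(ℝ, E) p q))) = _
  rw [(extChartAt 𝓘(ℝ, E) p).left_inv hq]

variable [IsManifold 𝓘(ℂ, E) ω M]

theorem chartField_mfderiv {p q : M} (hq : q ∈ (extChartAt 𝓘(ℝ, E) p).source)
    (k : TangentSpace 𝓘(ℝ, E) q) :
    chartField (E := E) p (mfderiv 𝓘(ℝ, E) 𝓘(ℝ, E) (extChartAt 𝓘(ℝ, E) p) q k) q = k :=
  (isInvertible_mfderiv_extChartAt hq).inverse_apply_eq.2 rfl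

theorem mfderiv_chartField {p q : M} (hq : q ∈ (extChartAt 𝓘(ℝ, E) p).source) (w : E) :
    mfderiv 𝓘(ℝ, E) 𝓘(ℝ, E) (extChartAt 𝓘(ℝ, E) p) q (chartField p w q) = w :=
  ((isInvertible_mfderiv_extChartAt hq).inverse_apply_eq.1 rfl).symm

theorem chartForm_mfderiv (θ : Π q : M, TangentSpace 𝓘(ℝ, E) q →L[ℝ] ℝ) {p q : M}
    (hq : q ∈ (extChartAt 𝓘(ℝ, E) p).source) (k : TangentSpace 𝓘(ℝ, E) q) :
    (chartForm θ p (extChartAt 𝓘(ℝ, E) p q) : E → ℝ)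
      (mfderiv 𝓘(ℝ, E) 𝓘(ℝ, E) (extChartAt 𝓘(ℝ, E) p) q k) = θ q k :=
  (chartForm_apply θ hq _).trans (congrArg (θ q) (chartField_mfderiv hq k))

variable [FiniteDimensional ℂ E]

theorem smoothVFAt_chartField (p : M) (w : E) : SmoothVFAt (chartField p w) p := by
  have : CompleteSpace E := FiniteDimensional.complete ℂ E
  refine ContMDiffAt.mpullback_vectorField_preimage (n := ∞) ?_ contMDiffAt_extChartAt
    (isInvertible_mfderiv_extChartAt (mem_extChartAt_source p)) (by simp)
  exact contMDiffAt_vectorSpace_iff_contDiffAt.2 contDiffAt_const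

theorem mlieBracket_chartField (p : M) (w z : E) :
    VectorField.mlieBracket 𝓘(ℝ, E) (chartField p w) (chartField p z) p = 0 := by
  have : CompleteSpace E := FiniteDimensional.complete ℂ E
  have hc : ∀ c : E, MDifferentiableAt 𝓘(ℝ, E) (𝓘(ℝ, E).prod 𝓘(ℝ, E))
      (fun y : E => (⟨y, c⟩ : Bundle.TotalSpace E (fun y : E => TangentSpace 𝓘(ℝ, E) y)))
      (extChartAt 𝓘(ℝ, E) p p) := fun c =>
    (contMDiffAt_vectorSpace_iff_contDiffAt (n := 1) (V := fun _ : E => c)).2 contDiffAt_const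
      |>.mdifferentiableAt one_ne_zero
  have : IsManifold 𝓘(ℝ, E) (minSmoothness ℝ 2) M :=
    IsManifold.of_le (n := ∞) (by rw [minSmoothness_of_isRCLikeNormedField]; norm_cast)
  have h := VectorField.mpullback_mlieBracket (x₀ := p) (hc w) (hc z)
    (contMDiffAt_extChartAt (I := 𝓘(ℝ, E)) (n := minSmoothness ℝ 2)) le_rfl
  have h0 : VectorField.mlieBracket 𝓘(ℝ, E) (fun _ : E => w) (fun _ : E => z) = fun _ => 0 := by
    refine VectorField.mlieBracketWithin_univ.symm.trans ?_
    refine VectorField.mlieBracketWithin_eq_lieBracketWithin.trans ?_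
    ext
    simp [VectorField.lieBracketWithin]
    rfl
  refine h.symm.trans ?_
  rw [h0]
  exact map_zero _

theorem differentiableAt_chartForm {θ : Π q : M, TangentSpace 𝓘(ℝ, E) q →L[ℝ] ℝ} {p : M}
    (hθ : ∀ Y : Π q : M, TangentSpace 𝓘(ℝ, E) q, SmoothVFAt Y p →
      MDifferentiableAt 𝓘(ℝ, E) 𝓘(ℝ) (fun q => θ q (Y q)) p) :
    DifferentiableAt ℝ (chartForm θ p) (extChartAt 𝓘(ℝ, E) p p) := by
  have : FiniteDimensional ℝ E := FiniteDimensional.complexToReal E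
  refine differentiableAt_of_apply fun w => ?_
  have h := hθ _ (smoothVFAt_chartField p w)
  have := MDifferentiableWithinAt.differentiableWithinAt_comp_extChartAt_symm
    (mdifferentiableWithinAt_univ.2 h)
  exact this.differentiableAt (by simp)

theorem mvfderiv_oneForm_chartField {θ : Π q : M, TangentSpace 𝓘(ℝ, E) q →L[ℝ] ℝ} {p : M}
    (hθ : ∀ Y : Π q : M, TangentSpace 𝓘(ℝ, E) q, SmoothVFAt Y p →
      MDifferentiableAt 𝓘(ℝ, E) 𝓘(ℝ) (fun q => θ q (Y q)) p) (w z : E) :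
    mvfderiv 𝓘(ℝ, E) (fun q => θ q (chartField p z q)) p (chartField p w p) =
      fderiv ℝ (chartForm θ p) (extChartAt 𝓘(ℝ, E) p p) w z := by
  have hd := differentiableAt_chartForm hθ
  have hs := mem_extChartAt_source (I := 𝓘(ℝ, E)) p
  have hev : (fun q => θ q (chartField p z q)) =ᶠ[𝓝 p]
      (fun y => chartForm θ p y z) ∘ extChartAt 𝓘(ℝ, E) p := by
    filter_upwards [extChartAt_source_mem_nhds (I := 𝓘(ℝ, E)) p] with q hq
    exact (chartForm_apply θ hq z).symm
  have hd' : HasFDerivAt (fun y => chartForm θ p y z)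
      ((fderiv ℝ (chartForm θ p) (extChartAt 𝓘(ℝ, E) p p)).flip z) (extChartAt 𝓘(ℝ, E) p p) := by
    have := hd.hasFDerivAt.clm_apply (hasFDerivAt_const z (extChartAt 𝓘(ℝ, E) p p))
    simpa using this
  have h1 := (hd'.hasMFDerivAt.comp p
    (mdifferentiableAt_extChartAt (I := 𝓘(ℝ, E)) (mem_chart_source E p)).hasMFDerivAt
    ).congr_of_eventuallyEq hev
  have h2 := congrArg (fun T => T (chartField p w p)) h1.mfderiv
  refine h2.trans ?_
  change fderiv ℝ (chartForm θ p) (extChartAt 𝓘(ℝ, E) p p)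
    (mfderiv 𝓘(ℝ, E) 𝓘(ℝ, E) (extChartAt 𝓘(ℝ, E) p) p (chartField p w p)) z = _
  rw [mfderiv_chartField hs]

theorem extD_chartField {θ : Π q : M, TangentSpace 𝓘(ℝ, E) q →L[ℝ] ℝ} {p : M}
    (hθ : ∀ Y : Π q : M, TangentSpace 𝓘(ℝ, E) q, SmoothVFAt Y p →
      MDifferentiableAt 𝓘(ℝ, E) 𝓘(ℝ) (fun q => θ q (Y q)) p) (w z : E) :
    extD (fun q => θ q) (chartField p w) (chartField p z) p =
      (1 / 2) * (fderiv ℝ (chartForm θ p) (extChartAt 𝓘(ℝ, E) p p) w z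
        - fderiv ℝ (chartForm θ p) (extChartAt 𝓘(ℝ, E) p p) z w) := by
  rw [extD, mvfderiv_oneForm_chartField hθ, mvfderiv_oneForm_chartField hθ,
    mlieBracket_chartField, map_zero, sub_zero]

end Pullback

section Naturality

variable {E : Type*} [NormedAddCommGroup E] [NormedSpace ℂ E]
  {M : Type*} [TopologicalSpace M] [ChartedSpace E M] [IsManifold 𝓘(ℂ, E) ω M]
  {E' : Type*} [NormedAddCommGroup E'] [NormedSpace ℂ E']
  {N : Type*} [TopologicalSpace N] [ChartedSpace E' N] [IsManifold 𝓘(ℂ, E') ω N]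

/-- The differential of a map, read in charts. -/
theorem eventually_fderiv_writtenInExtChartAt {f : N → M} {p : N}
    (hf : ContMDiffAt 𝓘(ℝ, E') 𝓘(ℝ, E) 2 f p) :
    ∀ᶠ q in 𝓝 p, f q ∈ (extChartAt 𝓘(ℝ, E) (f p)).source ∧
      ∀ k : TangentSpace 𝓘(ℝ, E') q,
      fderiv ℝ (writtenInExtChartAt 𝓘(ℝ, E') 𝓘(ℝ, E) p f) (extChartAt 𝓘(ℝ, E') p q)
        (mfderiv 𝓘(ℝ, E') 𝓘(ℝ, E') (extChartAt 𝓘(ℝ, E') p) q k) =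
      mfderiv 𝓘(ℝ, E) 𝓘(ℝ, E) (extChartAt 𝓘(ℝ, E) (f p)) (f q) (df E E' f q k) := by
  have hF : ContDiffAt ℝ 2 (writtenInExtChartAt 𝓘(ℝ, E') 𝓘(ℝ, E) p f)
      (extChartAt 𝓘(ℝ, E') p p) := by
    have := (contMDiffAt_iff.1 hf).2
    simpa [writtenInExtChartAt, contDiffWithinAt_univ] using this
  have hψ := continuousAt_extChartAt (I := 𝓘(ℝ, E')) p
  have : IsManifold 𝓘(ℝ, E) 2 M := IsManifold.of_le (n := ∞) (by norm_cast)
  have : IsManifold 𝓘(ℝ, E') 2 N := IsManifold.of_le (n := ∞) (by norm_cast)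
  filter_upwards [(contMDiffAt_iff_contMDiffAt_nhds (by norm_num)).1 hf,
    hψ.eventually (hF.eventually (by norm_num)),
    hf.continuousAt.eventually (extChartAt_source_mem_nhds (I := 𝓘(ℝ, E)) (f p)),
    extChartAt_source_mem_nhds (I := 𝓘(ℝ, E')) p] with q h1 h2 h3 h4
  refine ⟨h3, fun k => ?_⟩
  have e1 := ((h2.differentiableAt (by norm_num)).hasFDerivAt.hasMFDerivAt).comp q
    (mdifferentiableAt_extChartAt (I := 𝓘(ℝ, E')) (by simpa using h4)).hasMFDerivAt
  have e2 := (mdifferentiableAt_extChartAt (I := 𝓘(ℝ, E)) (y := f q) (x := f p)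
    (by rwa [extChartAt_source] at h3)).hasMFDerivAt.comp q (h1.mdifferentiableAt (by norm_num)).hasMFDerivAt
  have hev : writtenInExtChartAt 𝓘(ℝ, E') 𝓘(ℝ, E) p f ∘ extChartAt 𝓘(ℝ, E') p =ᶠ[𝓝 q]
      extChartAt 𝓘(ℝ, E) (f p) ∘ f := by
    filter_upwards [extChartAt_source_mem_nhds' (I := 𝓘(ℝ, E')) h4] with r hr
    simp only [writtenInExtChartAt, Function.comp_apply, (extChartAt 𝓘(ℝ, E') p).left_inv hr]
  exact congrArg (fun T => T k) (hasMFDerivAt_unique e1 (e2.congr_of_eventuallyEq hev))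

/-- A vector field read in a chart. -/
theorem eventually_mpullbackWithin_extChartAt_symm (p : N)
    (K : Π q : N, TangentSpace 𝓘(ℝ, E') q) :
    ∀ᶠ q in 𝓝 p, VectorField.mpullbackWithin 𝓘(ℝ, E') 𝓘(ℝ, E') (extChartAt 𝓘(ℝ, E') p).symm K
        (Set.range 𝓘(ℝ, E')) (extChartAt 𝓘(ℝ, E') p q) =
      mfderiv 𝓘(ℝ, E') 𝓘(ℝ, E') (extChartAt 𝓘(ℝ, E') p) q (K q) := by
  have h := VectorField.eventuallyEq_mpullback_mpullbackWithin_extChartAt (I := 𝓘(ℝ, E'))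
    (x := p) (s := Set.univ) K
  rw [nhdsWithin_univ] at h
  filter_upwards [h, extChartAt_source_mem_nhds (I := 𝓘(ℝ, E')) p] with q hq hs
  exact (isInvertible_mfderiv_extChartAt hs).inverse_apply_eq.1 hq.symm

variable [FiniteDimensional ℂ E] [FiniteDimensional ℂ E']

/-- Naturality of the exterior derivative, for vector fields on which the pulled back form
vanishes. -/
theorem exists_extD_eq_pullback {θ : Π q : M, TangentSpace 𝓘(ℝ, E) q →L[ℝ] ℝ} {f : N → M} {p : N}
    (hf : ContMDiffAt 𝓘(ℝ, E') 𝓘(ℝ, E) 2 f p)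
    (hθ : ∀ Y : Π q : M, TangentSpace 𝓘(ℝ, E) q, SmoothVFAt Y (f p) →
      MDifferentiableAt 𝓘(ℝ, E) 𝓘(ℝ) (fun q => θ q (Y q)) (f p))
    {K L : Π q : N, TangentSpace 𝓘(ℝ, E') q} (hK : SmoothVFAt K p) (hL : SmoothVFAt L p)
    (hθK : ∀ᶠ q in 𝓝 p, θ (f q) (df E E' f q (K q)) = 0)
    (hθL : ∀ᶠ q in 𝓝 p, θ (f q) (df E E' f q (L q)) = 0) :
    ∃ X Y : Π q : M, TangentSpace 𝓘(ℝ, E) q, SmoothVFAt X (f p) ∧ SmoothVFAt Y (f p) ∧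
      X (f p) = df E E' f p (K p) ∧ Y (f p) = df E E' f p (L p) ∧
      extD (fun q => θ q) X Y (f p) =
        -(1 / 2) * θ (f p) (df E E' f p (VectorField.mlieBracket 𝓘(ℝ, E') K L p)) := by
  have : FiniteDimensional ℝ E := FiniteDimensional.complexToReal E
  have : CompleteSpace E' := FiniteDimensional.complete ℂ E'
  have : IsManifold 𝓘(ℝ, E') 2 N := IsManifold.of_le (n := ∞) (by norm_cast)
  set ψ := extChartAt 𝓘(ℝ, E') p with hψdef
  set φ := extChartAt 𝓘(ℝ, E) (f p) with hφdef
  let F : E' → E := writtenInExtChartAt 𝓘(ℝ, E') 𝓘(ℝ, E) p f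
  have hFp : F (ψ p) = φ (f p) := by simp [F, writtenInExtChartAt, hψdef, hφdef]
  have hF : ContDiffAt ℝ 2 F (ψ p) := by
    have := (contMDiffAt_iff.1 hf).2
    simpa [F, hψdef, writtenInExtChartAt, contDiffWithinAt_univ] using this
  let hat (A : Π q : N, TangentSpace 𝓘(ℝ, E') q) : E' → E' :=
    VectorField.mpullbackWithin 𝓘(ℝ, E') 𝓘(ℝ, E') ψ.symm A (Set.range 𝓘(ℝ, E'))
  have hdhat : ∀ {A}, SmoothVFAt A p → DifferentiableAt ℝ (hat A) (ψ p) := by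
    intro A hA
    have h0 : MDifferentiableAt 𝓘(ℝ, E') (𝓘(ℝ, E').prod 𝓘(ℝ, E')) (fun q => (⟨q, A q⟩ :
      Bundle.TotalSpace E' (fun q : N => TangentSpace 𝓘(ℝ, E') q))) p :=
      ContMDiffAt.mdifferentiableAt hA (by simp)
    have := (mdifferentiableWithinAt_univ.2 h0
      ).differentiableWithinAt_mpullbackWithin_vectorField
    exact this.differentiableAt (by simp)
  have hchart : ∀ A : Π q : N, TangentSpace 𝓘(ℝ, E') q, ∀ᶠ q in 𝓝 p,
      f q ∈ φ.source ∧ fderiv ℝ F (ψ q) (hat A (ψ q)) =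
        mfderiv 𝓘(ℝ, E) 𝓘(ℝ, E) φ (f q) (df E E' f q (A q)) := by
    intro A
    filter_upwards [eventually_fderiv_writtenInExtChartAt hf,
      eventually_mpullbackWithin_extChartAt_symm p A] with q h1 h2
    refine ⟨h1.1, ?_⟩
    rw [← h1.2]
    exact congrArg _ h2
  have hvan : ∀ {A : Π q : N, TangentSpace 𝓘(ℝ, E') q},
      (∀ᶠ q in 𝓝 p, θ (f q) (df E E' f q (A q)) = 0) →
      ∀ᶠ x in 𝓝 (ψ p), chartForm θ (f p) (F x) (fderiv ℝ F x (hat A x)) = 0 := by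
    intro A hA
    have hq : ∀ᶠ q in 𝓝 p,
        chartForm θ (f p) (F (ψ q)) (fderiv ℝ F (ψ q) (hat A (ψ q))) = 0 := by
      filter_upwards [hA, hchart A, extChartAt_source_mem_nhds (I := 𝓘(ℝ, E')) p] with q h1 h2 h3
      have hFq : F (ψ q) = φ (f q) := by
        simp only [F, writtenInExtChartAt, Function.comp_apply, ← hψdef, ψ.left_inv h3, ← hφdef]
      rw [hFq, h2.2]
      exact (chartForm_mfderiv θ h2.1 _).trans h1
    have ht := (continuousAt_extChartAt_symm (I := 𝓘(ℝ, E')) p).tendsto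
    rw [extChartAt_to_inv] at ht
    filter_upwards [ht.eventually hq, extChartAt_target_mem_nhds (I := 𝓘(ℝ, E')) p] with x h1 h2
    rwa [← hψdef, ψ.right_inv h2] at h1
  have hs := mem_extChartAt_source (I := 𝓘(ℝ, E)) (f p)
  have hflat := fderiv_oneForm_pullback hF (Θ := chartForm θ (f p))
    (by rw [hFp]; exact differentiableAt_chartForm hθ) (hdhat hK) (hdhat hL) (hvan hθK) (hvan hθL)
  refine ⟨chartField (f p) (fderiv ℝ F (ψ p) (hat K (ψ p))),
    chartField (f p) (fderiv ℝ F (ψ p) (hat L (ψ p))), smoothVFAt_chartField _ _,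
    smoothVFAt_chartField _ _, ?_, ?_, ?_⟩
  · rw [(hchart K).self_of_nhds.2, chartField_mfderiv hs]
  · rw [(hchart L).self_of_nhds.2, chartField_mfderiv hs]
  · have hbr : fderiv ℝ F (ψ p) (VectorField.lieBracket ℝ (hat K) (hat L) (ψ p)) =
        mfderiv 𝓘(ℝ, E) 𝓘(ℝ, E) φ (f p)
          (df E E' f p (VectorField.mlieBracket 𝓘(ℝ, E') K L p)) := by
      rw [← (eventually_fderiv_writtenInExtChartAt hf).self_of_nhds.2]
      refine congrArg _ ?_
      have h1 : VectorField.mlieBracket 𝓘(ℝ, E') K L p = (mfderiv 𝓘(ℝ, E') 𝓘(ℝ, E') ψ p).inverse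
          (VectorField.lieBracket (E := E') ℝ (hat K) (hat L) (ψ p)) := by
        rw [← VectorField.mlieBracketWithin_univ, VectorField.mlieBracketWithin_apply]
        have hu : (extChartAt 𝓘(ℝ, E') p).symm ⁻¹' Set.univ ∩ Set.range 𝓘(ℝ, E') = Set.univ := by
          simp
        rw [hu]
        exact congrArg (fun Z : E' => (mfderiv 𝓘(ℝ, E') 𝓘(ℝ, E') ψ p).inverse Z)
          (congrFun VectorField.lieBracketWithin_univ _)
      exact (isInvertible_mfderiv_extChartAt (mem_extChartAt_source p)).inverse_apply_eq.1 h1.symm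
    have hθbr := chartForm_mfderiv θ hs (df E E' f p (VectorField.mlieBracket 𝓘(ℝ, E') K L p))
    rw [extD_chartField hθ, ← hφdef, ← hFp, hflat, hFp, hbr, ← hθbr]
    ring

end Naturality

section Holomorphic

variable {E : Type*} [NormedAddCommGroup E] [NormedSpace ℂ E]
  {M : Type*} [TopologicalSpace M] [ChartedSpace E M]
  {E' : Type*} [NormedAddCommGroup E'] [NormedSpace ℂ E']
  {N : Type*} [TopologicalSpace N] [ChartedSpace E' N]

theorem contMDiffAt_real_of_holomorphic {f : N → M}
    (hf : ContMDiff 𝓘(ℂ, E') 𝓘(ℂ, E) ω f) (p : N) : ContMDiffAt 𝓘(ℝ, E') 𝓘(ℝ, E) 2 f p := by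
  obtain ⟨hc, hd⟩ := contMDiffAt_iff.1 (hf p)
  exact contMDiffAt_iff.2 ⟨hc, (hd.restrict_scalars ℝ).of_le (by exact_mod_cast le_top)⟩

/-- The differential of a holomorphic map commutes with the complex structures. -/
theorem df_J {f : N → M} (hf : ContMDiff 𝓘(ℂ, E') 𝓘(ℂ, E) ω f) (p : N)
    (k : TangentSpace 𝓘(ℝ, E') p) : df E E' f p (J p k) = J (f p) (df E E' f p k) := by
  have hC : MDifferentiableAt 𝓘(ℂ, E') 𝓘(ℂ, E) f p := (hf p).mdifferentiableAt (by simp)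
  have hR : MDifferentiableAt 𝓘(ℝ, E') 𝓘(ℝ, E) f p :=
    (contMDiffAt_real_of_holomorphic hf p).mdifferentiableAt (by norm_num)
  let T : E' →L[ℂ] E := mfderiv 𝓘(ℂ, E') 𝓘(ℂ, E) f p
  have h : HasMFDerivAt 𝓘(ℝ, E') 𝓘(ℝ, E) f p (T.restrictScalars ℝ) :=
    ⟨hR.continuousAt, hC.hasMFDerivAt.2.restrictScalars ℝ⟩
  have hdf : df E E' f p = T.restrictScalars ℝ := h.mfderiv
  rw [hdf]
  exact T.map_smul Complex.I k

end Holomorphic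

section Structure

variable {E : Type*} [NormedAddCommGroup E] [NormedSpace ℂ E]
  {M : Type*} [TopologicalSpace M] [ChartedSpace E M]

theorem J_J (p : M) (k : TangentSpace 𝓘(ℝ, E) p) : J p (J p k) = -k := by
  have h (x : E) : Complex.I • Complex.I • x = -x := by
    rw [smul_smul, Complex.I_mul_I, neg_one_smul]
  exact h k

variable [Bundle.RiemannianBundle (fun p : M => TangentSpace 𝓘(ℝ, E) p)]
  {ι : Type*} {S : LocalFields E M ι}
  {E' : Type*} [NormedAddCommGroup E'] [NormedSpace ℂ E']
  {N : Type*} [TopologicalSpace N] [ChartedSpace E' N] {f : N → M}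

/-- The `1`-form `u` as a field of continuous linear forms. -/
def uForm (S : LocalFields E M ι) (i : ι) (p : M) : TangentSpace 𝓘(ℝ, E) p →L[ℝ] ℝ :=
  innerSL ℝ (S.U i p)

theorem uForm_apply (p : M) (i : ι) (k : TangentSpace 𝓘(ℝ, E) p) :
    uForm S i p k = S.u i p k := by
  rw [uForm, innerSL_apply_apply]
  exact real_inner_comm _ _

/-- Vectors of `D ⊕ D^⊥` are orthogonal to `U`. -/
theorem u_df_of_mem_sup {p : N} {i : ι} (hi : f p ∈ S.dom i) {k : TangentSpace 𝓘(ℝ, E') p}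
    (hk : k ∈ distD S f p ⊔ distDPerp S f p) : S.u i (f p) (df E E' f p k) = 0 := by
  obtain ⟨a, ha, b, hb, rfl⟩ := Submodule.mem_sup.1 hk
  have h1 := (ha i hi).1
  have h2 := (hb i hi).1
  rw [LocalFields.u, map_add, inner_add_left, h1, h2, add_zero]

variable [IsManifold 𝓘(ℂ, E) ω M]

namespace LocalFields.IsComplexAlmostContactMetric

variable (hS : S.IsComplexAlmostContactMetric) {i : ι} {p : M} (hp : p ∈ S.dom i)
include hS

theorem inner_J_right (k l : TangentSpace 𝓘(ℝ, E) p) :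
    inner ℝ k (J p l) = -inner ℝ (J p k) l := by
  rw [← hS.hermitian p k, J_J, inner_neg_right]

theorem v_eq (k : TangentSpace 𝓘(ℝ, E) p) : S.v i p k = inner ℝ k (S.V i p) := by
  rw [LocalFields.V, inner_neg_right, hS.inner_J_right, neg_neg]
  rfl

include hp

theorem u_G (k : TangentSpace 𝓘(ℝ, E) p) : S.u i p (S.G i p k) = 0 := by
  have h := hS.G_skew i p hp k (S.U i p)
  rw [hS.G_U i p hp, inner_zero_right] at h
  exact neg_eq_zero.1 h.symm

theorem v_G (k : TangentSpace 𝓘(ℝ, E) p) : S.v i p (S.G i p k) = 0 := by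
  have h := hS.G_J i p hp k
  rw [LocalFields.v, ← neg_neg (J p _), ← h]
  have := hS.u_G hp (J p k)
  simp only [LocalFields.u, inner_neg_left, neg_eq_zero] at this ⊢
  exact this

theorem G_G {k : TangentSpace 𝓘(ℝ, E) p} (hu : S.u i p k = 0) (hv : S.v i p k = 0) :
    S.G i p (S.G i p k) = -k := by
  rw [hS.G_sq i p hp, hu, hv, zero_smul, zero_smul, add_zero, add_zero]

theorem H_G {k : TangentSpace 𝓘(ℝ, E) p} (hu : S.u i p k = 0) (hv : S.v i p k = 0) :
    S.H i p (S.G i p k) = J p k := by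
  change S.G i p (J p (S.G i p k)) = _
  rw [hS.G_J i p hp, hS.G_G hp hu hv, map_neg, neg_neg]

end LocalFields.IsComplexAlmostContactMetric

/-- The distribution `D` is invariant under `G`. -/
theorem exists_mem_distD_df_eq_G (hS : S.IsComplexAlmostContactMetric)
    (hf : ContMDiff 𝓘(ℂ, E') 𝓘(ℂ, E) ω f) {p : N} {i : ι} (hi : f p ∈ S.dom i)
    {k : TangentSpace 𝓘(ℝ, E') p} (hk : k ∈ distD S f p) :
    ∃ l ∈ distD S f p, df E E' f p l = S.G i (f p) (df E E' f p k) := by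
  obtain ⟨hu, hv, l, hl⟩ := hk i hi
  rw [← hS.v_eq] at hv
  change S.u i (f p) _ = 0 at hu
  change df E E' f p l = _ at hl
  refine ⟨l, fun j hj => ?_, hl⟩
  rw [← hS.v_eq, hl]
  obtain ⟨c, d, -, h⟩ := hS.overlap i j (f p) ⟨hi, hj⟩
  obtain ⟨h1, h2, h3, -⟩ := h (S.G i (f p) (df E E' f p k))
  rw [hS.u_G hi, hS.v_G hi, mul_zero, mul_zero] at h1 h2
  refine ⟨h1.trans (sub_zero 0), h2.trans (add_zero 0), ?_⟩
  rw [h3, hS.G_G hi hu hv, hS.H_G hi hu hv, ← df_J hf]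
  exact Submodule.sub_mem _ (Submodule.smul_mem _ _ (Submodule.neg_mem _ ⟨k, rfl⟩))
    (Submodule.smul_mem _ _ ⟨_, rfl⟩)

variable [IsContMDiffRiemannianBundle 𝓘(ℝ, E) ∞ E (fun p : M => TangentSpace 𝓘(ℝ, E) p)]

theorem mdifferentiableAt_uForm (hS : S.IsComplexAlmostContactMetric) {i : ι} {p : M}
    (hp : p ∈ S.dom i) {Y : Π q : M, TangentSpace 𝓘(ℝ, E) q} (hY : SmoothVFAt Y p) :
    MDifferentiableAt 𝓘(ℝ, E) 𝓘(ℝ) (fun q => uForm S i q (Y q)) p := by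
  have h := ContMDiffAt.inner_bundle (IB := 𝓘(ℝ, E)) (n := ∞) (F := E)
    (E := fun q : M => TangentSpace 𝓘(ℝ, E) q) (b := fun q => q)
    (v := S.U i) (w := Y) (hS.smooth_U i p hp) hY
  exact h.mdifferentiableAt (by simp)

/-- If `D ⊕ D^⊥` is involutive and `D` is smooth, then `D = 0`. -/
theorem distD_eq_bot_of_isInvolutive [FiniteDimensional ℂ E] [FiniteDimensional ℂ E']
    [T2Space N] [IsManifold 𝓘(ℂ, E') ω N]
    {nabla : CovariantDerivative 𝓘(ℝ, E) E (fun p : M => TangentSpace 𝓘(ℝ, E) p)}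
    (hS : S.IsComplexContactMetric nabla) (hf : IsComplexSubmanifold E E' f)
    (hD : IsSmoothDistribution (distD (E' := E') S f))
    (hinv : IsInvolutive (fun p : N => distD (E' := E') S f p ⊔ distDPerp S f p)) (p : N) :
    distD (E' := E') S f p = ⊥ := by
  refine (Submodule.eq_bot_iff _).2 fun k hk => ?_
  have hA := hS.toIsComplexAlmostContactMetric
  obtain ⟨i, hi⟩ := Set.mem_iUnion.1 (hA.cover.symm ▸ Set.mem_univ (f p))
  obtain ⟨l, hl, hlG⟩ := exists_mem_distD_df_eq_G hA hf.holomorphic hi hk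
  obtain ⟨K, rfl, hKs, hKD⟩ := hD.exists_global hk
  obtain ⟨L, rfl, hLs, hLD⟩ := hD.exists_global hl
  have hf2 := contMDiffAt_real_of_holomorphic hf.holomorphic p
  have hdom : ∀ᶠ q in 𝓝 p, f q ∈ S.dom i :=
    hf2.continuousAt.eventually ((hA.isOpen_dom i).mem_nhds hi)
  have hvan : ∀ A : Π q : N, TangentSpace 𝓘(ℝ, E') q, (∀ q, A q ∈ distD S f q) →
      ∀ᶠ q in 𝓝 p, uForm S i (f q) (df E E' f q (A q)) = 0 := fun A hA => by
    filter_upwards [hdom] with q hq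
    exact (uForm_apply _ _ _).trans (hA q i hq).1
  obtain ⟨X, Y, hX, hY, hXp, hYp, hXY⟩ := exists_extD_eq_pullback hf2
    (fun Y hY => mdifferentiableAt_uForm hA hi hY) (hKs p) (hLs p) (hvan K hKD) (hvan L hLD)
  have hbr := u_df_of_mem_sup hi (hinv K L hKs hLs (fun q => Submodule.mem_sup_left (hKD q))
    (fun q => Submodule.mem_sup_left (hLD q)) p)
  have hu : S.u i (f p) (df E E' f p (K p)) = 0 := (hk i hi).1
  have hv : S.v i (f p) (df E E' f p (K p)) = 0 := (hA.v_eq _).trans (hk i hi).2.1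
  rw [uForm_apply, hbr, mul_zero] at hXY
  have hdu := hS.d_u i (f p) hi X Y hX hY
  have huF : (fun q => (uForm S i q : TangentSpace 𝓘(ℝ, E) q → ℝ)) = S.u i :=
    funext fun q => funext fun k => uForm_apply q i k
  rw [← huF, hXY, hXp, hYp, hlG, hA.G_G hi hu hv, wedge, hA.v_G hi, hv, inner_neg_right] at hdu
  have h0 : inner ℝ (df E E' f p (K p)) (df E E' f p (K p)) = (0 : ℝ) := by linarith
  exact hf.immersion p ((inner_self_eq_zero.1 h0).trans (map_zero _).symm)

end Structure

end ComplexContact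

end

theorem mainTheorem4 {m : ℕ} {E : Type*} [NormedAddCommGroup E] [NormedSpace ℂ E]
    [FiniteDimensional ℂ E] (hE : Module.finrank ℂ E = 2 * m + 1)
    {M : Type*} [TopologicalSpace M] [T2Space M] [ChartedSpace E M] [IsManifold 𝓘(ℂ, E) ω M]
    [Bundle.RiemannianBundle (fun p : M => TangentSpace 𝓘(ℝ, E) p)]
    [IsContMDiffRiemannianBundle 𝓘(ℝ, E) ∞ E (fun p : M => TangentSpace 𝓘(ℝ, E) p)]
    (nabla : CovariantDerivative 𝓘(ℝ, E) E (fun p : M => TangentSpace 𝓘(ℝ, E) p))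
    (hnabla : ComplexContact.IsLeviCivita nabla)
    {ι : Type*} (S : ComplexContact.LocalFields E M ι)
    (hcontact : S.IsComplexContactMetric nabla) (hnormal : S.IsNormal nabla)
    {E' : Type*} [NormedAddCommGroup E'] [NormedSpace ℂ E'] [FiniteDimensional ℂ E']
    {N : Type*} [TopologicalSpace N] [T2Space N] [ChartedSpace E' N] [IsManifold 𝓘(ℂ, E') ω N]
    (f : N → M) (hf : ComplexContact.IsProperSemiInvariant E' S f) :
    ¬ ComplexContact.IsInvolutive
      (fun p : N => ComplexContact.distD (E' := E') S f p ⊔ ComplexContact.distDPerp S f p) := by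
  intro hinv
  refine hf.not_antiInvariant fun p => ?_
  rw [ComplexContact.distD_eq_bot_of_isInvolutive hcontact hf.submanifold hf.smooth_D hinv p]
  exact finrank_bot ℝ _
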